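/- Let $n\ge 1$ and let $\lambda_1>\dots>\lambda_n$ be real numbers with $\sum_i\lambda_i=0$. Identify $\mathfrak{su}(n)^*$ with the space of traceless Hermitian $n\times n$ matrices, so that the coadjoint action of $SU(n)$ is conjugation, and let $M$ be the (regular) coadjoint orbit of $SU(n)$ through $\mathrm{diag}(\lambda_1,\dots,\lambda_n)$, with its Kostant–Kirillov symplectic form $\omega$. Call a subset $L\subset M$ displaceable if there is a Hamiltonian diffeomorphism $\phi\in\mathrm{Ham}(M,\omega)$ (a time-one map of the flow of a smooth time-dependent Hamiltonian) with $\phi(L)\cap L=\emptyset$. Let $\mu\colon M\to\mathbb{R}^n$, $\mu([a_{ij}])=(a_{11},\dots,a_{nn})$, be the momentum map of the diagonal torus. Let $\Lambda\colon M\to\mathbb{R}^{n(n-1)/2}$, $\Lambda(A)=(\lambda^{(k)}_j(A))_{1\le j\le k\le n-1}$, be the Gelfand–Tsetlin system, where $\lambda^{(k)}_1(A)\ge\dots\ge\lambda^{(k)}_k(A)$ are the eigenvalues of the top left $k\times k$ submatrix of $A$, and let $\mathcal{P}=\Lambda(M)$ be the Gelfand–Tsetlin polytope. Define $pr\colon\mathbb{R}^{n(n-1)/2}\to\mathbb{R}^n$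 by $pr(x)_k=\sum_j x^{(k)}_j-\sum_j x^{(k-1)}_j$ for $1\le k\le n$, where $x^{(n)}_j=\lambda_j$ and the sum at level $0$ is $0$; thus $\mu=pr\circ\Lambda$. Put $\mathcal{W}=pr^{-1}(0,\dots,0)$. Then for every $x\in\mathcal{P}\setminus\mathcal{W}$ the Gelfand–Tsetlin fiber $\Lambda^{-1}(x)$ is displaceable. Moreover $\Lambda^{-1}(x)\subset\mu^{-1}(pr(x))$, and the fiber $\mu^{-1}(pr(x))$ is itself displaceable. -/

import Mathlib

open scoped ContDiff

namespace GelfandTsetlin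

noncomputable section

/-- Complex `n × n` matrices, as a finite-dimensional real vector space. -/
abbrev Mat (n : ℕ) : Type := Matrix (Fin n) (Fin n) ℂ

/- A norm is needed to speak of derivatives; the choice is immaterial in finite dimension. -/
attribute [local instance] Matrix.linftyOpNormedRing Matrix.linftyOpNormedAlgebra

/-- The Lie algebra `su(n)`: traceless skew-Hermitian matrices. -/
def su (n : ℕ) : Submodule ℝ (Mat n) where
  carrier := {X | star X = -X ∧ X.trace = 0}
  add_mem' := by
    rintro X Y ⟨hX, hX'⟩ ⟨hY, hY'⟩
    exact ⟨by rw [star_add, hX, hY, neg_add], by rw [Matrix.trace_add, hX', hY', add_zero]⟩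
  zero_mem' := ⟨by simp, by simp⟩
  smul_mem' := by
    rintro c X ⟨hX, hX'⟩
    exact ⟨by rw [star_smul, hX, star_trivial, smul_neg], by rw [Matrix.trace_smul, hX', smul_zero]⟩

/-- The pairing `⟨A, X⟩ = -i tr (A X)` between Hermitian traceless matrices `A` and `X ∈ su(n)`
(where `tr (A X)` is purely imaginary), which identifies the former with the dual of `su(n)`.
Under it the coadjoint action is conjugation. -/
def pairing {n : ℕ} (A X : Mat n) : ℝ := (A * X).trace.im

/-- The coadjoint orbit of `SU(n)` through `diag (lam 0, …, lam (n-1))`. -/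
def orbit {n : ℕ} (lam : Fin n → ℝ) : Set (Mat n) :=
  {A | ∃ g ∈ Matrix.specialUnitaryGroup (Fin n) ℂ,
    A = g * Matrix.diagonal (fun i => (lam i : ℂ)) * star g}

theorem orbit_isHermitian {n : ℕ} {lam : Fin n → ℝ} {A : Mat n} (hA : A ∈ orbit lam) :
    A.IsHermitian := by
  obtain ⟨g, -, rfl⟩ := hA
  refine Matrix.isHermitian_mul_mul_conjTranspose g ?_
  rw [Matrix.isHermitian_diagonal_iff]
  intro i
  simp [IsSelfAdjoint]

/-! ### The Kostant–Kirillov form -/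

/-- The infinitesimal coadjoint action `X ↦ [X, A]`, the velocity at `t = 0` of
`exp (t X) A exp (-t X)`. -/
def infAction {n : ℕ} (A : Mat n) : Mat n →ₗ[ℝ] Mat n :=
  LinearMap.mulRight ℝ A - LinearMap.mulLeft ℝ A

theorem infAction_apply {n : ℕ} (A X : Mat n) : infAction A X = X * A - A * X := rfl

/-- The tangent space at `A` of the coadjoint orbit of `A`: all `[X, A]` with `X ∈ su(n)`. -/
def tangentSpace {n : ℕ} (A : Mat n) : Submodule ℝ (Mat n) := (su n).map (infAction A)

/-- Some `X ∈ su(n)` with `[X, A] = v`. -/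
def lift {n : ℕ} {A : Mat n} (v : tangentSpace A) : Mat n :=
  Classical.choose (Submodule.mem_map.1 v.2)

theorem infAction_lift {n : ℕ} {A : Mat n} (v : tangentSpace A) : infAction A (lift v) = v :=
  (Classical.choose_spec (Submodule.mem_map.1 v.2)).2

/-- `⟨A, [X, Y]⟩` depends on `X` and `Y` only through `[X, A]` and `[Y, A]`. -/
theorem pairing_bracket_left {n : ℕ} (A X Y : Mat n) :
    pairing A (X * Y - Y * X) = -(infAction A X * Y).trace.im := by
  have h : (A * (Y * X)).trace = (X * A * Y).trace := by
    rw [← mul_assoc, Matrix.trace_mul_comm, mul_assoc]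
  rw [pairing, mul_sub, Matrix.trace_sub, h, infAction_apply, sub_mul, Matrix.trace_sub,
    ← mul_assoc, Complex.sub_im, Complex.sub_im, neg_sub]

theorem pairing_bracket_right {n : ℕ} (A X Y : Mat n) :
    pairing A (X * Y - Y * X) = (infAction A Y * X).trace.im := by
  have h : pairing A (X * Y - Y * X) = -pairing A (Y * X - X * Y) := by
    rw [pairing, pairing, ← neg_sub, mul_neg, Matrix.trace_neg, Complex.neg_im]
  rw [h, pairing_bracket_left, neg_neg]

/-- The Kostant–Kirillov form at `A`: `ω_A ([X, A], [Y, A]) = ⟨A, [X, Y]⟩`, see `kks_apply`. -/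
def kks {n : ℕ} (A : Mat n) : tangentSpace A →ₗ[ℝ] tangentSpace A →ₗ[ℝ] ℝ :=
  LinearMap.mk₂ ℝ (fun v w => pairing A (lift v * lift w - lift w * lift v))
    (fun v v' w => by
      simp only [pairing_bracket_left, infAction_lift, Submodule.coe_add, add_mul,
        Matrix.trace_add, Complex.add_im]
      ring)
    (fun c v w => by
      simp only [pairing_bracket_left, infAction_lift, Submodule.coe_smul, smul_mul_assoc,
        Matrix.trace_smul, Complex.smul_im, smul_eq_mul]
      ring)
    (fun v w w' => by
      simp only [pairing_bracket_right, infAction_lift, Submodule.coe_add, add_mul,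
        Matrix.trace_add, Complex.add_im])
    (fun c v w => by
      simp only [pairing_bracket_right, infAction_lift, Submodule.coe_smul, smul_mul_assoc,
        Matrix.trace_smul, Complex.smul_im])

/-- The form does not depend on the choice of lifts. -/
theorem kks_apply {n : ℕ} (A : Mat n) (v w : tangentSpace A) (X Y : Mat n)
    (hX : infAction A X = v) (hY : infAction A Y = w) :
    kks A v w = pairing A (X * Y - Y * X) := by
  change pairing A (lift v * lift w - lift w * lift v) = _
  rw [pairing_bracket_left, infAction_lift, ← hX, ← pairing_bracket_left, pairing_bracket_right,
    infAction_lift, ← hY, ← pairing_bracket_right]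

/-! ### Hamiltonian isotopies -/

/-- `v` is the value at `A` of the Hamiltonian vector field of `F`: `ω_A (v, ·) = dF_A` on the
tangent space of the orbit. Only the restriction of `F` to the orbit matters. -/
def IsHamiltonianVector {n : ℕ} (F : Mat n → ℝ) (A : Mat n) (v : tangentSpace A) : Prop :=
  ∀ w : tangentSpace A, kks A v w = fderiv ℝ F A (w : Mat n)

/-- `φ` (at times in `[0, 1]`) is the flow, starting at the identity, of the time-dependent
Hamiltonian vector field of `H` on the orbit. -/
def IsHamiltonianIsotopy {n : ℕ} (lam : Fin n → ℝ) (H : ℝ → Mat n → ℝ)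
    (φ : ℝ → orbit lam → orbit lam) : Prop :=
  (∀ A, φ 0 A = A) ∧
  ∀ t ∈ Set.Icc (0 : ℝ) 1, ∀ A : orbit lam, ∃ v : tangentSpace (φ t A : Mat n),
    IsHamiltonianVector (H t) (φ t A : Mat n) v ∧
    HasDerivWithinAt (fun s => (φ s A : Mat n)) (v : Mat n) (Set.Icc 0 1) t

/-- Elements of `Ham (M, ω)` for `M` the orbit: time-one maps of the flows of smooth
time-dependent Hamiltonians. As `M` is a compact embedded submanifold, the smooth functions on
`ℝ × M` are exactly the restrictions of smooth functions on `ℝ × Mat n`. -/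
def IsHamiltonianDiffeo {n : ℕ} (lam : Fin n → ℝ) (ψ : orbit lam → orbit lam) : Prop :=
  ∃ (H : ℝ → Mat n → ℝ) (φ : ℝ → orbit lam → orbit lam),
    ContDiff ℝ ∞ (fun p : ℝ × Mat n => H p.1 p.2) ∧ IsHamiltonianIsotopy lam H φ ∧ φ 1 = ψ

/-- `L` is displaceable: some Hamiltonian diffeomorphism makes it disjoint from itself. -/
def Displaceable {n : ℕ} (lam : Fin n → ℝ) (L : Set (orbit lam)) : Prop :=
  ∃ ψ : orbit lam → orbit lam, IsHamiltonianDiffeo lam ψ ∧ (ψ '' L) ∩ L = ∅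

/-! ### The momentum map of the maximal torus and the Gelfand–Tsetlin system -/

/-- The momentum map of the diagonal torus: the diagonal entries. -/
def mu {n : ℕ} (lam : Fin n → ℝ) (A : orbit lam) : Fin n → ℝ := fun i => (A.1 i i).re

/-- The space of the Gelfand–Tsetlin coordinates `x k j`, with `k < n` and `j < k`: level `k` has
`k` coordinates (none for `k = 0`), in all `n (n - 1) / 2`. -/
abbrev GTSpace (n : ℕ) : Type := (k : Fin n) → Fin k → ℝ

/-- The top left `k × k` submatrix. -/
def topLeft {n : ℕ} (k : Fin n) (A : Mat n) : Matrix (Fin k) (Fin k) ℂ :=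
  A.submatrix (Fin.castLE k.2.le) (Fin.castLE k.2.le)

theorem topLeft_isHermitian {n : ℕ} (k : Fin n) {A : Mat n} (hA : A.IsHermitian) :
    (topLeft k A).IsHermitian :=
  hA.submatrix _

/-- The Gelfand–Tsetlin system: `Λ A k j` is the `j`-th eigenvalue, in non-increasing order and
with multiplicity, of the top left `k × k` submatrix of `A`. -/
def gtMap {n : ℕ} (lam : Fin n → ℝ) (A : orbit lam) : GTSpace n := fun k j =>
  (topLeft_isHermitian k (orbit_isHermitian A.2)).eigenvalues₀
    (Fin.cast (Fintype.card_fin k).symm j)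

/-- The Gelfand–Tsetlin polytope, the image of the Gelfand–Tsetlin system. -/
def gtPolytope {n : ℕ} (lam : Fin n → ℝ) : Set (GTSpace n) := Set.range (gtMap lam)

/-- The sum of the coordinates at level `k`; level `n` consists of the numbers `lam i`. -/
def levelSum {n : ℕ} (lam : Fin n → ℝ) (x : GTSpace n) (k : ℕ) : ℝ :=
  if h : k < n then ∑ j, x ⟨k, h⟩ j else ∑ i, lam i

/-- The projection `pr` from Gelfand–Tsetlin coordinates to the dual of the Lie algebra of the
diagonal torus: differences of consecutive level sums. -/
def pr {n : ℕ} (lam : Fin n → ℝ) (x : GTSpace n) : Fin n → ℝ := fun i =>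
  levelSum lam x (i + 1) - levelSum lam x i

/-- The set `W = pr ⁻¹ (0)`. -/
def centralSet {n : ℕ} (lam : Fin n → ℝ) : Set (GTSpace n) := pr lam ⁻¹' {0}

end

end GelfandTsetlin

namespace GelfandTsetlin

attribute [local instance] Matrix.linftyOpNormedRing Matrix.linftyOpNormedAlgebra

/-! ### The Gelfand–Tsetlin system and the diagonal entries -/

/-! Traces of consecutive corners differ by a diagonal entry, so `pr` of the Gelfand–Tsetlin
coordinates is the torus momentum map (`pr_gtMap`), and it suffices to displace the fibre of `mu`
over `p = pr x`. The entries of `p` sum to zero but are not all zero, so two of them differ, say at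
`a` and `b`. Conjugation by the transposition matrix `P` of `a` and `b` permutes diagonal entries,
hence carries this fibre into a different one (`displaceable_mu_fiber`). This conjugation is
Hamiltonian: `P = 1 - 2Q` with `Q` an orthogonal projection, so `P = exp (iπQ)`, and conjugation by
`exp (iπtQ)` is the flow of a linear Hamiltonian. -/

theorem trace_re_of_mem_orbit {n : ℕ} {lam : Fin n → ℝ} {A : Mat n} (hA : A ∈ orbit lam) :
    A.trace.re = ∑ i, lam i := by
  obtain ⟨g, hg, rfl⟩ := hA
  have h : star g * g = 1 :=
    Matrix.mem_unitaryGroup_iff'.1 (Matrix.mem_specialUnitaryGroup_iff.1 hg).1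
  rw [mul_assoc, Matrix.trace_mul_comm, mul_assoc, h, mul_one, Matrix.trace_diagonal]
  simp

theorem sum_eigenvalues₀ {k : ℕ} {B : Matrix (Fin k) (Fin k) ℂ} (hB : B.IsHermitian) :
    ∑ j, hB.eigenvalues₀ (Fin.cast (Fintype.card_fin k).symm j) = B.trace.re := by
  have h : B.trace.re = ∑ i, hB.eigenvalues i := by
    rw [hB.trace_eq_sum_eigenvalues]
    simp
  refine ((finCongr (Fintype.card_fin k).symm).sum_comp (fun j => hB.eigenvalues₀ j)).trans ?_
  rw [h]
  exact (((Fintype.equivOfCardEq (Fintype.card_fin _)).symm).sum_comp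
    (fun j => hB.eigenvalues₀ j)).symm

theorem levelSum_gtMap {n : ℕ} (lam : Fin n → ℝ) (A : orbit lam) {k : ℕ} (hk : k ≤ n) :
    levelSum lam (gtMap lam A) k = ∑ j : Fin k, (A.1 (Fin.castLE hk j) (Fin.castLE hk j)).re := by
  rcases hk.lt_or_eq with h | rfl
  · rw [levelSum, dif_pos h]
    unfold gtMap
    rw [sum_eigenvalues₀, Matrix.trace, Complex.re_sum]
    rfl
  · rw [levelSum, dif_neg (lt_irrefl _), ← trace_re_of_mem_orbit A.2, Matrix.trace,
      Complex.re_sum]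
    rfl

theorem pr_gtMap {n : ℕ} (lam : Fin n → ℝ) (A : orbit lam) :
    pr lam (gtMap lam A) = mu lam A := by
  ext i
  rw [pr, levelSum_gtMap lam A (Nat.succ_le_of_lt i.2), levelSum_gtMap lam A i.2.le,
    Fin.sum_univ_castSucc]
  exact add_sub_cancel_left _ _

theorem sum_mu {n : ℕ} (lam : Fin n → ℝ) (A : orbit lam) : ∑ i, mu lam A i = ∑ i, lam i := by
  rw [← trace_re_of_mem_orbit A.2, Matrix.trace, Complex.re_sum]
  rfl

/-! ### Unitary conjugation -/

/-- The orbits of `SU(n)` are invariant under `U(n)`. -/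
theorem conj_mem_orbit {n : ℕ} {lam : Fin n → ℝ} {A U : Mat n} (hA : A ∈ orbit lam)
    (hU : U ∈ Matrix.unitaryGroup (Fin n) ℂ) : U * A * star U ∈ orbit lam := by
  obtain ⟨g, hg, rfl⟩ := hA
  rcases Nat.eq_zero_or_pos n with rfl | hn
  · exact ⟨g, hg, Subsingleton.elim _ _⟩
  obtain ⟨hg, hdet⟩ := Matrix.mem_specialUnitaryGroup_iff.1 hg
  -- An `n`-th root `z` of the conjugate of `det U` makes `det (z U g) = 1`; since `|z| = 1`, it
  -- cancels in the conjugation.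
  obtain ⟨z, hz⟩ := IsAlgClosed.exists_pow_nat_eq (star U.det) hn
  have hUd : star U.det * U.det = 1 := (Unitary.mem_iff.1 (Matrix.det_of_mem_unitary hU)).1
  have hnorm : ‖U.det‖ = 1 := by
    have h := congrArg norm hUd
    rw [norm_mul, norm_star, norm_one] at h
    nlinarith [norm_nonneg U.det]
  have hz1 : ‖z‖ = 1 := by
    refine (pow_eq_one_iff_of_nonneg (norm_nonneg z) hn.ne').1 ?_
    rw [← norm_pow, hz, norm_star, hnorm]
  have hzz : z * star z = 1 := by
    rw [Complex.star_def, Complex.mul_conj, Complex.normSq_eq_norm_sq, hz1]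
    simp
  refine ⟨z • (U * g), ?_, ?_⟩
  · refine Matrix.mem_specialUnitaryGroup_iff.2 ⟨?_, ?_⟩
    · have h := Matrix.mem_unitaryGroup_iff.1 (mul_mem hU hg)
      rw [Matrix.mem_unitaryGroup_iff, star_smul, smul_mul_smul_comm, h, hzz, one_smul]
    · rw [Matrix.det_smul, Matrix.det_mul, hdet, Fintype.card_fin, hz, mul_one, hUd]
  · rw [star_smul, smul_mul_assoc, smul_mul_smul_comm, hzz, one_smul, star_mul]
    simp only [mul_assoc]

/-- A skew-Hermitian matrix acts on the orbit by tangent vectors: its trace is irrelevant. -/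
theorem infAction_mem_tangentSpace {n : ℕ} (A : Mat n) {Y : Mat n} (hY : star Y = -Y) :
    infAction A Y ∈ tangentSpace A := by
  rcases Nat.eq_zero_or_pos n with rfl | hn
  · rw [Subsingleton.elim (infAction A Y) 0]
    exact zero_mem _
  have htr : star Y.trace = -Y.trace := by
    rw [← Matrix.trace_neg, ← hY]
    exact (Matrix.trace_conjTranspose Y).symm
  have hn' : (n : ℂ) ≠ 0 := Nat.cast_ne_zero.2 hn.ne'
  -- Removing the scalar part of `Y` leaves its bracket with `A` unchanged; the trace is imaginary,
  -- so the rest stays skew-Hermitian.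
  refine Submodule.mem_map.2 ⟨Y - (Y.trace / n) • (1 : Mat n), ⟨?_, ?_⟩, ?_⟩
  · rw [star_sub, star_smul, hY, star_one, star_div₀, htr, star_natCast, neg_div, neg_smul]
    abel
  · rw [Matrix.trace_sub, Matrix.trace_smul, Matrix.trace_one, Fintype.card_fin, smul_eq_mul,
      div_mul_cancel₀ _ hn', sub_self]
  · simp only [infAction_apply, sub_mul, mul_sub, smul_mul_assoc, mul_smul_comm, one_mul, mul_one]
    abel

/-- The momentum map of the conjugation action in the direction `Y`. -/
noncomputable def pairingCLM {n : ℕ} (Y : Mat n) : Mat n →L[ℝ] ℝ :=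
  LinearMap.toContinuousLinearMap
    (Complex.imLm ∘ₗ Matrix.traceLinearMap (Fin n) ℝ ℂ ∘ₗ LinearMap.mulRight ℝ Y)

theorem pairingCLM_apply {n : ℕ} (A Y : Mat n) : pairingCLM Y A = pairing A Y := rfl

/-- By cyclicity of the trace, `ω_A ([Y, A], w)` is the imaginary part of `tr (w Y)`, which is the
linear Hamiltonian, its own derivative, evaluated at `w`. -/
theorem isHamiltonianVector_infAction {n : ℕ} (A Y : Mat n) (v : tangentSpace A)
    (hv : infAction A Y = v) : IsHamiltonianVector (pairingCLM Y) A v := by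
  intro w
  rw [kks_apply A v w Y (lift w) hv (infAction_lift w), pairing_bracket_right, infAction_lift,
    ContinuousLinearMap.fderiv, pairingCLM_apply, pairing]

/-- Conjugation by a path of unitaries with `U' = Y U`, `Y` constant, is a Hamiltonian isotopy. -/
theorem isHamiltonianDiffeo_conj {n : ℕ} (lam : Fin n → ℝ) {Y : Mat n} (hY : star Y = -Y)
    (U : ℝ → Mat n) (hU : ∀ t, U t ∈ Matrix.unitaryGroup (Fin n) ℂ) (hU0 : U 0 = 1)
    (hd : ∀ t, HasDerivAt U (Y * U t) t) (hd' : ∀ t, HasDerivAt (fun s => star (U s))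
      (-(star (U t) * Y)) t) :
    IsHamiltonianDiffeo lam fun A => ⟨U 1 * A * star (U 1), conj_mem_orbit A.2 (hU 1)⟩ := by
  refine ⟨fun _ => pairingCLM Y, fun t A => ⟨U t * A * star (U t), conj_mem_orbit A.2 (hU t)⟩,
    (pairingCLM Y).contDiff.comp contDiff_snd, ⟨fun A => Subtype.ext ?_, fun t _ A => ?_⟩, rfl⟩
  · simp [hU0]
  · refine ⟨⟨_, infAction_mem_tangentSpace _ hY⟩, isHamiltonianVector_infAction _ Y _ rfl, ?_⟩
    -- The product rule gives velocity `Y B - B Y` at the moving point `B = U A U*`.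
    have h := (((hd t).mul_const A.1).mul (hd' t)).hasDerivWithinAt (s := Set.Icc 0 1)
    refine h.congr_deriv ?_
    simp only [infAction_apply, mul_neg, ← sub_eq_add_neg, mul_assoc]

/-! ### Transpositions are Hamiltonian -/

section Projection

variable {n : ℕ} {Q : Mat n}

/-- The one-parameter group `exp (i π t Q)` for a projection `Q`. -/
noncomputable def projFlow (Q : Mat n) (t : ℝ) : Mat n :=
  1 + (Complex.exp (t * (Real.pi * Complex.I)) - 1) • Q

theorem mul_projFlow (hQ : Q * Q = Q) (t : ℝ) :
    Q * projFlow Q t = Complex.exp (t * (Real.pi * Complex.I)) • Q := by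
  rw [projFlow, mul_add, mul_one, mul_smul_comm, hQ, sub_smul, one_smul, add_sub_cancel]

theorem projFlow_mul (hQ : Q * Q = Q) (t : ℝ) :
    projFlow Q t * Q = Complex.exp (t * (Real.pi * Complex.I)) • Q := by
  rw [projFlow, add_mul, one_mul, smul_mul_assoc, hQ, sub_smul, one_smul, add_sub_cancel]

theorem star_projFlow (hQ : star Q = Q) (t : ℝ) : star (projFlow Q t) = projFlow Q (-t) := by
  rw [projFlow, projFlow, star_add, star_one, star_smul, hQ, star_sub, star_one,
    Complex.star_def, ← Complex.exp_conj]
  simp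

theorem projFlow_zero (Q : Mat n) : projFlow Q 0 = 1 := by simp [projFlow]

theorem projFlow_one (Q : Mat n) : projFlow Q 1 = 1 - (2 : ℂ) • Q := by
  rw [projFlow, Complex.ofReal_one, one_mul, Complex.exp_pi_mul_I, sub_eq_add_neg 1, ← neg_smul]
  norm_num

theorem projFlow_mul_projFlow_neg (hQ : Q * Q = Q) (t : ℝ) :
    projFlow Q t * projFlow Q (-t) = 1 := by
  have h : Complex.exp (t * (Real.pi * Complex.I)) *
      Complex.exp ((-t : ℝ) * (Real.pi * Complex.I)) = 1 := by
    rw [← Complex.exp_add, ← Complex.exp_zero]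
    congr 1
    push_cast
    ring
  conv_lhs => rw [projFlow, add_mul, one_mul, smul_mul_assoc, mul_projFlow hQ, smul_smul, sub_mul,
    h, one_mul, projFlow, add_assoc, ← add_smul]
  simp

theorem hasDerivAt_projFlow (hQ : Q * Q = Q) (t : ℝ) :
    HasDerivAt (projFlow Q) (((Real.pi * Complex.I) • Q) * projFlow Q t) t := by
  have h : HasDerivAt (fun s : ℝ => Complex.exp (s * (Real.pi * Complex.I)) - 1)
      (Complex.exp (t * (Real.pi * Complex.I)) * (1 * (Real.pi * Complex.I))) t :=
    ((Complex.ofRealCLM.hasDerivAt.mul_const _).cexp).sub_const 1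
  refine ((h.smul_const Q).const_add 1).congr_deriv ?_
  rw [smul_mul_assoc, mul_projFlow hQ, smul_smul, one_mul, mul_comm]

theorem isHamiltonianDiffeo_projFlow (lam : Fin n → ℝ) (hQ : Q * Q = Q) (hQ' : star Q = Q) :
    ∃ ψ : orbit lam → orbit lam, IsHamiltonianDiffeo lam ψ ∧
      ∀ A, (ψ A : Mat n) = (1 - (2 : ℂ) • Q) * A * (1 - (2 : ℂ) • Q) := by
  have hstar : star (1 - (2 : ℂ) • Q) = 1 - (2 : ℂ) • Q := by
    simp [star_sub, star_smul, hQ']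
  refine ⟨_, isHamiltonianDiffeo_conj lam (Y := (Real.pi * Complex.I) • Q) ?_ (projFlow Q)
    (fun t => ?_) (projFlow_zero Q) (hasDerivAt_projFlow hQ) (fun t => ?_), fun A => ?_⟩
  · rw [star_smul, hQ', ← neg_smul]
    simp
  · rw [Matrix.mem_unitaryGroup_iff, star_projFlow hQ', projFlow_mul_projFlow_neg hQ]
  · simp only [star_projFlow hQ']
    refine ((hasDerivAt_projFlow hQ (-t)).scomp t (hasDerivAt_neg t)).congr_deriv ?_
    rw [smul_mul_assoc, mul_smul_comm, mul_projFlow hQ, projFlow_mul hQ, neg_one_smul]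
  · simp only [projFlow_one, hstar]

end Projection

/-- The matrix `P` of a transposition is a self-adjoint involution, so `(1 - P) / 2` is an
orthogonal projection. For `a ≠ b`, `det P = -1`, which is why invariance of the orbit under all of
`U(n)` is needed. -/
theorem isHamiltonianDiffeo_swap {n : ℕ} (lam : Fin n → ℝ) (a b : Fin n) :
    ∃ ψ : orbit lam → orbit lam, IsHamiltonianDiffeo lam ψ ∧
      ∀ A i, mu lam (ψ A) i = mu lam A (Equiv.swap a b i) := by
  set P : Mat n := (Equiv.swap a b).permMatrix ℂ with hP
  have hPP : P * P = 1 := by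
    rw [hP, ← Matrix.permMatrix_mul, Equiv.swap_mul_self, Matrix.permMatrix_one]
  have hPs : star P = P := by
    rw [hP, Matrix.star_eq_conjTranspose, Matrix.conjTranspose_permMatrix, Equiv.swap_inv]
  obtain ⟨ψ, hψ, h⟩ := isHamiltonianDiffeo_projFlow lam (Q := (2⁻¹ : ℂ) • (1 - P))
    (by
      rw [smul_mul_smul_comm, mul_sub, sub_mul, sub_mul, hPP, one_mul, mul_one, one_mul]
      have : (1 : Mat n) - P - (P - 1) = (2 : ℂ) • (1 - P) := by rw [two_smul]; abel
      rw [this, smul_smul]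
      norm_num)
    (by simp [star_smul, hPs])
  refine ⟨ψ, hψ, fun A i => ?_⟩
  have hQP : 1 - (2 : ℂ) • ((2⁻¹ : ℂ) • (1 - P)) = P := by
    rw [smul_smul, mul_inv_cancel₀ two_ne_zero, one_smul, sub_sub_cancel]
  rw [mu, h, hQP, hP, Equiv.Perm.permMatrix, PEquiv.toMatrix_toPEquiv_mul,
    PEquiv.mul_toMatrix_toPEquiv, Matrix.submatrix_apply, Matrix.submatrix_apply,
    Equiv.symm_swap]
  rfl

/-! ### Displaceability -/

theorem Displaceable.mono {n : ℕ} {lam : Fin n → ℝ} {L L' : Set (orbit lam)}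
    (h : Displaceable lam L') (hL : L ⊆ L') : Displaceable lam L := by
  obtain ⟨ψ, hψ, hd⟩ := h
  exact ⟨ψ, hψ, Set.subset_eq_empty (Set.inter_subset_inter (Set.image_mono hL) hL) hd⟩

/-- Only over a point fixed by all permutations can a fibre of the momentum map of the diagonal
torus fail to be displaceable. -/
theorem displaceable_mu_fiber {n : ℕ} (lam : Fin n → ℝ) {p : Fin n → ℝ} {a b : Fin n}
    (hab : p a ≠ p b) : Displaceable lam (mu lam ⁻¹' {p}) := by
  obtain ⟨ψ, hψ, h⟩ := isHamiltonianDiffeo_swap lam a b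
  refine ⟨ψ, hψ, Set.eq_empty_iff_forall_notMem.2 ?_⟩
  rintro _ ⟨⟨A, hA, rfl⟩, hA'⟩
  rw [Set.mem_preimage, Set.mem_singleton_iff] at hA hA'
  have := h A a
  rw [hA, hA', Equiv.swap_apply_left] at this
  exact hab this

theorem exists_ne_of_sum_eq_zero {n : ℕ} {p : Fin n → ℝ} (hp : p ≠ 0) (hsum : ∑ i, p i = 0) :
    ∃ a b, p a ≠ p b := by
  by_contra! h
  obtain ⟨a, ha⟩ := Function.ne_iff.1 hp
  -- A constant vector with sum zero satisfies `n * p a = 0`; the index `a` itself shows `n ≠ 0`.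
  have hn : (n : ℝ) ≠ 0 := Nat.cast_ne_zero.2 a.pos.ne'
  rw [Finset.sum_congr rfl fun i _ => h i a] at hsum
  simp_all

end GelfandTsetlin

theorem mainTheorem5 (n : ℕ) (lam : Fin n → ℝ) (hlam : StrictAnti lam) (hsum : ∑ i, lam i = 0)
    (x : GelfandTsetlin.GTSpace n)
    (hx : x ∈ GelfandTsetlin.gtPolytope lam \ GelfandTsetlin.centralSet lam) :
    GelfandTsetlin.Displaceable lam (GelfandTsetlin.gtMap lam ⁻¹' {x}) ∧
    GelfandTsetlin.gtMap lam ⁻¹' {x} ⊆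
      GelfandTsetlin.mu lam ⁻¹' {GelfandTsetlin.pr lam x} ∧
    GelfandTsetlin.Displaceable lam
      (GelfandTsetlin.mu lam ⁻¹' {GelfandTsetlin.pr lam x}) := by
  obtain ⟨⟨A, rfl⟩, hx⟩ := hx
  have hsub : GelfandTsetlin.gtMap lam ⁻¹' {GelfandTsetlin.gtMap lam A} ⊆
      GelfandTsetlin.mu lam ⁻¹' {GelfandTsetlin.pr lam (GelfandTsetlin.gtMap lam A)} :=
    fun B hB => (GelfandTsetlin.pr_gtMap lam B).symm.trans (congrArg _ hB)
  obtain ⟨a, b, hab⟩ := GelfandTsetlin.exists_ne_of_sum_eq_zero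
    (p := GelfandTsetlin.pr lam (GelfandTsetlin.gtMap lam A)) hx
    (by rw [GelfandTsetlin.pr_gtMap, GelfandTsetlin.sum_mu, hsum])
  have hd := GelfandTsetlin.displaceable_mu_fiber lam hab
  exact ⟨hd.mono hsub, hsub, hd⟩
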